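/- Let $(\mathcal X,\mathcal B)$ be a measurable space, $P$ a probability measure on it, and $\mathcal M$ the real vector space of all signed finite measures on $(\mathcal X,\mathcal B)$. Let $\varphi:\mathbb R\to[0,+\infty]$ be a convex function with $\varphi(1)=0$ whose domain $\{x:\varphi(x)<\infty\}$ is an interval with endpoints $a_\varphi<1<b_\varphi$ (finite or infinite), and which is closed: if $a_\varphi$ (resp. $b_\varphi$) is finite, then $\varphi(x)\to\varphi(a_\varphi)$ as $x\downarrow a_\varphi$ (resp. $\varphi(x)\to\varphi(b_\varphi)$ as $x\uparrow b_\varphi$). For $Q\in\mathcal M$ put $$\phi(Q,P):=\int_{\mathcal X}\varphi\Big(\frac{dQ}{dP}\Big)\,dP$$ if $Q$ is absolutely continuous with respect to $P$, and $\phi(Q,P):=+\infty$ otherwise. Let the $\tau$-topology on $\mathcal M$ be the weakest topology for which $Q\mapsto\int f\,dQ$ is continuous for every bounded measurable $f:\mathcal X\to\mathbb R$. Let $\Omega\subseteq\mathcal M$ be closed in the $\tau$-topology. Assume that $$\phi(\Omega,P):=\inf_{Q\in\Omega}\phi(Q,P)<\infty\qquad\text{and}\qquad \lim_{|x|\to\infty}\frac{\varphi(x)}{|x|}=+\infty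 .$$ Then there exists at least one $\phi$-projection of $P$ on $\Omega$, that is, a measure $Q^*\in\Omega$ such that $\phi(Q^*,P)\le\phi(Q,P)$ for all $Q\in\Omega$. -/

import Mathlib

open MeasureTheory Filter Topology
open scoped ENNReal

/-- The effective domain of a function `φ : ℝ → [0, +∞]`. -/
def effDom (φ : ℝ → ℝ≥0∞) : Set ℝ := {x | φ x < ∞}

/-- The lower endpoint of the effective domain, as an extended real. -/
noncomputable def lowerEndpoint (φ : ℝ → ℝ≥0∞) : EReal :=
  sInf ((fun x : ℝ => (x : EReal)) '' effDom φ)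

/-- The upper endpoint of the effective domain, as an extended real. -/
noncomputable def upperEndpoint (φ : ℝ → ℝ≥0∞) : EReal :=
  sSup ((fun x : ℝ => (x : EReal)) '' effDom φ)

/-- Closed convex functions `φ : ℝ → [0, +∞]` with `φ 1 = 0` whose effective domain is an interval
with endpoints `a < 1 < b` (finite or infinite). They are proper because `1` is in the domain. -/
structure IsDivergenceFunction (φ : ℝ → ℝ≥0∞) : Prop where
  convex : ∀ x y s t : ℝ, 0 ≤ s → 0 ≤ t → s + t = 1 →
    φ (s * x + t * y) ≤ ENNReal.ofReal s * φ x + ENNReal.ofReal t * φ y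
  map_one : φ 1 = 0
  ordConnected_effDom : (effDom φ).OrdConnected
  lowerEndpoint_lt_one : lowerEndpoint φ < 1
  one_lt_upperEndpoint : 1 < upperEndpoint φ
  closed_lower : ∀ a : ℝ, lowerEndpoint φ = a → Tendsto φ (𝓝[>] a) (𝓝 (φ a))
  closed_upper : ∀ b : ℝ, upperEndpoint φ = b → Tendsto φ (𝓝[<] b) (𝓝 (φ b))

open Classical in
/-- The `φ`-divergence `∫ φ (dQ/dP) dP` of a signed finite measure `Q` with respect to `P`, equal
to `+∞` when `Q` is not absolutely continuous with respect to `P`. -/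
noncomputable def phiDiv {X : Type*} [MeasurableSpace X] (φ : ℝ → ℝ≥0∞)
    (Q : SignedMeasure X) (P : Measure X) : ℝ≥0∞ :=
  if VectorMeasure.AbsolutelyContinuous Q P.toENNRealVectorMeasure then
    ∫⁻ x, φ (Q.rnDeriv P x) ∂P
  else ∞

/-- The divergence between a set `Ω` of signed finite measures and `P`. -/
noncomputable def phiDivSet {X : Type*} [MeasurableSpace X] (φ : ℝ → ℝ≥0∞)
    (Ω : Set (SignedMeasure X)) (P : Measure X) : ℝ≥0∞ :=
  ⨅ Q ∈ Ω, phiDiv φ Q P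

/-- `Q'` is a `φ`-projection of `P` on `Ω`. -/
def IsPhiProjection {X : Type*} [MeasurableSpace X] (φ : ℝ → ℝ≥0∞)
    (P : Measure X) (Ω : Set (SignedMeasure X)) (Q' : SignedMeasure X) : Prop :=
  Q' ∈ Ω ∧ ∀ Q ∈ Ω, phiDiv φ Q' P ≤ phiDiv φ Q P

/-- The `τ`-topology on the space of signed finite measures: the weakest topology that makes
`Q ↦ ∫ f dQ` continuous for every bounded measurable `f : X → ℝ`. -/
@[reducible] noncomputable def tauTopology (X : Type*) [MeasurableSpace X] :
    TopologicalSpace (SignedMeasure X) :=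
  ⨅ (f : X → ℝ) (_ : Measurable f) (_ : ∃ C : ℝ, ∀ x, |f x| ≤ C),
    TopologicalSpace.induced (fun Q : SignedMeasure X => ∫ᵛ x, f x ∂•Q) inferInstance

/-! This is the direct method. Along a minimising sequence `Q n`, with densities `q n`, the
integrals of `φ (q n)` are bounded. Superlinear growth turns this bound into `∫_A |q n| ≤ R * P(A) +
ε`, with `R` independent of `n` and `A` (`isEquiintegrable_of_lintegral_le`). Along an ultrafilter
every `∫_A q n` converges, and the uniform bound makes the limit countably additive and absolutely
continuous (`IsEquiintegrable.exists_signedMeasure`). Simple functions extend the convergence to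
bounded measurable integrands, so the limit is a `τ`-limit and lies in `Ω`.

Lower semicontinuity comes from duality. A closed convex `φ` is a supremum of countably many affine
functions. A finite maximum of these, evaluated at the limit density `q'`, equals `s * q' + r` with
`s`, `r` bounded and measurable. This expression is affine in the density, so its integral passes to
the limit, and monotone convergence recovers `φ`. -/

/-! ### Closed convex functions as suprema of affine minorants -/

/-- Pairs `(s, r)` such that the affine function `x ↦ s * x + r` lies below `φ`. -/
def affineMinorants (φ : ℝ → ℝ≥0∞) : Set (ℝ × ℝ) :=
  {p | ∀ x, ENNReal.ofReal (p.1 * x + p.2) ≤ φ x}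

/-- Convexity of an extended nonnegative function on the line. -/
def ENNRealConvex (φ : ℝ → ℝ≥0∞) : Prop :=
  ∀ x y s t : ℝ, 0 ≤ s → 0 ≤ t → s + t = 1 →
    φ (s * x + t * y) ≤ ENNReal.ofReal s * φ x + ENNReal.ofReal t * φ y

theorem ENNRealConvex.comp_neg {φ : ℝ → ℝ≥0∞} (hφ : ENNRealConvex φ) :
    ENNRealConvex (fun x => φ (-x)) := by
  intro x y s t hs ht hst
  have := hφ (-x) (-y) s t hs ht hst
  rwa [show s * -x + t * -y = -(s * x + t * y) by ring] at this

/-- The chord inequality, cleared of denominators and moved to `ℝ`. A real `t` below `φ x` stands in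
for `φ x`, so finiteness of `φ x` need not be discussed. -/
theorem ENNRealConvex.three_point {φ : ℝ → ℝ≥0∞} (hφ : ENNRealConvex φ) {y x z t : ℝ}
    (hyx : y < x) (hxz : x < z) (hy : φ y ≠ ∞) (hz : φ z ≠ ∞) (ht : ENNReal.ofReal t ≤ φ x) :
    t * (z - y) ≤ (z - x) * (φ y).toReal + (x - y) * (φ z).toReal := by
  have hzy : 0 < z - y := by linarith
  have h := hφ y z ((z - x) / (z - y)) ((x - y) / (z - y))
    (div_nonneg (by linarith) hzy.le) (div_nonneg (by linarith) hzy.le) (by field_simp; ring)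
  rw [show (z - x) / (z - y) * y + (x - y) / (z - y) * z = x by field_simp; ring] at h
  have h' := ht.trans h
  rw [← ENNReal.ofReal_toReal hy, ← ENNReal.ofReal_toReal hz,
    ← ENNReal.ofReal_mul (div_nonneg (by linarith) hzy.le),
    ← ENNReal.ofReal_mul (div_nonneg (by linarith) hzy.le),
    ← ENNReal.ofReal_add, ENNReal.ofReal_le_ofReal_iff] at h'
  · calc t * (z - y) ≤ _ := mul_le_mul_of_nonneg_right h' hzy.le
      _ = _ := by field_simp
  all_goals
    have := div_nonneg (sub_nonneg.2 hxz.le) hzy.le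
    have := div_nonneg (sub_nonneg.2 hyx.le) hzy.le
    positivity

theorem ENNRealConvex.eventually_le_nhdsLT {φ : ℝ → ℝ≥0∞} (hφ : ENNRealConvex φ) {x z t : ℝ}
    (hxz : x < z) (hz : φ z ≠ ∞) (h0 : 0 ≤ t) (ht : ENNReal.ofReal t < φ x) :
    ∀ᶠ y in 𝓝[<] x, ENNReal.ofReal t ≤ φ y := by
  obtain ⟨c, htc, hcx⟩ := exists_between ht
  have hc : c ≠ ∞ := hcx.ne_top
  have htc' : t < c.toReal := (ENNReal.ofReal_lt_iff_lt_toReal h0 hc).1 htc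
  -- At `y = x` this reads `(z - x) * t < c * (z - x)`, so it persists nearby. There `φ y < t` would
  -- contradict the chord inequality.
  have hlim : ∀ᶠ y in 𝓝 x, (z - x) * t + (x - y) * (φ z).toReal < c.toReal * (z - y) := by
    refine ContinuousAt.eventually_lt (by fun_prop) (by fun_prop) ?_
    nlinarith
  filter_upwards [nhdsWithin_le_nhds hlim, self_mem_nhdsWithin] with y hy hyx
  by_contra! hlt
  have hu : (φ y).toReal < t := ENNReal.toReal_lt_of_lt_ofReal hlt
  have h3 := hφ.three_point hyx hxz hlt.ne_top hz (t := c.toReal)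
    (by rw [ENNReal.ofReal_toReal hc]; exact hcx.le)
  nlinarith

theorem ENNRealConvex.eventually_le_nhdsGT {φ : ℝ → ℝ≥0∞} (hφ : ENNRealConvex φ) {x z t : ℝ}
    (hzx : z < x) (hz : φ z ≠ ∞) (h0 : 0 ≤ t) (ht : ENNReal.ofReal t < φ x) :
    ∀ᶠ y in 𝓝[>] x, ENNReal.ofReal t ≤ φ y := by
  have h := hφ.comp_neg.eventually_le_nhdsLT (neg_lt_neg hzx) (by simpa using hz) h0
    (by simpa using ht)
  simpa using (tendsto_neg_nhdsGT (a := x)).eventually h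

/-- A convex function vanishing at `c < x` that is at least `t > 0` just left of `x` has an affine
minorant exceeding `t` at `x`. -/
theorem ENNRealConvex.exists_affineMinorant_right {φ : ℝ → ℝ≥0∞} (hφ : ENNRealConvex φ)
    {c x t : ℝ} (hcx : c < x) (hc : φ c = 0) (h0 : 0 < t)
    (ht : ∀ᶠ y in 𝓝[<] x, ENNReal.ofReal t ≤ φ y) :
    ∃ p ∈ affineMinorants φ, t < p.1 * x + p.2 := by
  obtain ⟨l, hlx, hl⟩ := (mem_nhdsLT_iff_exists_Ioo_subset' hcx).1 ht
  obtain ⟨y₀, hy₀, hy₀x⟩ := exists_between (max_lt hcx hlx)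
  obtain ⟨x₁, hx₁, hx₁x⟩ := exists_between hy₀x
  have hcy₀ : c < y₀ := (le_max_left _ _).trans_lt hy₀
  have hbig : ∀ y, y₀ ≤ y → y ≤ x₁ → ENNReal.ofReal t ≤ φ y := fun y h1 h2 =>
    hl ⟨(le_max_right c l).trans_lt (hy₀.trans_le h1), h2.trans_lt hx₁x⟩
  -- Slopes from points of the graph left of `x₁` to `(x₁, t)`. The line through `(x₁, t)` with the
  -- largest such slope supports `φ` from below. Since `φ c = 0`, this slope is positive, and `x₁ <
  -- x` then gives a value above `t` at `x`.
  set S : Set ℝ := {m | ∃ y, y < x₁ ∧ φ y ≠ ∞ ∧ m = (t - (φ y).toReal) / (x₁ - y)} with hS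
  have hcS : t / (x₁ - c) ∈ S := ⟨c, by linarith, by simp [hc], by simp [hc]⟩
  have hbdd : BddAbove S := by
    refine ⟨t / (x₁ - y₀), ?_⟩
    rintro m ⟨y, hy, hfin, rfl⟩
    have hpos : 0 ≤ t / (x₁ - y₀) := div_nonneg h0.le (by linarith)
    rcases le_or_gt y₀ y with h | h
    · refine le_trans (div_nonpos_of_nonpos_of_nonneg ?_ (by linarith)) hpos
      have := (ENNReal.ofReal_le_iff_le_toReal hfin).1 (hbig y h hy.le)
      linarith
    · exact div_le_div₀ h0.le (by linarith [(φ y).toReal_nonneg]) (by linarith) (by linarith)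
  have hs0 : 0 < sSup S :=
    (div_pos h0 (by linarith : 0 < x₁ - c)).trans_le (le_csSup hbdd hcS)
  refine ⟨(sSup S, t - sSup S * x₁), fun y => ?_, ?_⟩
  · rcases eq_or_ne (φ y) ∞ with hfin | hfin
    · simp [hfin]
    rcases lt_trichotomy y x₁ with h | rfl | h
    · rw [ENNReal.ofReal_le_iff_le_toReal hfin]
      have := le_csSup hbdd (⟨y, h, hfin, rfl⟩ : (t - (φ y).toReal) / (x₁ - y) ∈ S)
      rw [div_le_iff₀ (by linarith)] at this
      dsimp only
      linarith
    · simpa using hbig y hx₁.le le_rfl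
    · rw [ENNReal.ofReal_le_iff_le_toReal hfin]
      -- By convexity, slopes from the left of `x₁` never exceed slopes to the right.
      have : sSup S ≤ ((φ y).toReal - t) / (y - x₁) := by
        refine csSup_le ⟨_, hcS⟩ ?_
        rintro m ⟨w, hw, hwfin, rfl⟩
        rw [div_le_div_iff₀ (by linarith) (by linarith)]
        have := hφ.three_point hw h hwfin hfin (hbig x₁ hx₁.le le_rfl)
        linarith
      rw [le_div_iff₀ (by linarith)] at this
      dsimp only
      linarith
  · dsimp only
    nlinarith

theorem ENNRealConvex.exists_affineMinorant_left {φ : ℝ → ℝ≥0∞} (hφ : ENNRealConvex φ)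
    {c x t : ℝ} (hxc : x < c) (hc : φ c = 0) (h0 : 0 < t)
    (ht : ∀ᶠ y in 𝓝[>] x, ENNReal.ofReal t ≤ φ y) :
    ∃ p ∈ affineMinorants φ, t < p.1 * x + p.2 := by
  obtain ⟨p, hp, hlt⟩ := hφ.comp_neg.exists_affineMinorant_right (neg_lt_neg hxc)
    (by simpa using hc) h0
    ((tendsto_neg_nhdsLT_neg (a := x)).eventually ht)
  refine ⟨(-p.1, p.2), fun y => ?_, by simpa using hlt⟩
  simpa using hp (-y)

namespace IsDivergenceFunction

variable {φ : ℝ → ℝ≥0∞}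

/-- It suffices that `φ ≥ t` near `x` on the side facing `1`. This follows from convexity between an
endpoint and `1`, from closedness at an endpoint, and from `φ = ∞` beyond it. -/
theorem exists_affineMinorant (hφ : IsDivergenceFunction φ) {x t : ℝ} (h0 : 0 < t)
    (ht : ENNReal.ofReal t < φ x) : ∃ p ∈ affineMinorants φ, t < p.1 * x + p.2 := by
  have hconv : ENNRealConvex φ := hφ.convex
  rcases lt_trichotomy x 1 with hx | rfl | hx
  · refine hconv.exists_affineMinorant_left hx hφ.map_one h0 ?_
    rcases lt_trichotomy (lowerEndpoint φ) x with h | h | h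
    · obtain ⟨_, ⟨z, hz, rfl⟩, hzx⟩ := sInf_lt_iff.1 h
      exact hconv.eventually_le_nhdsGT (EReal.coe_lt_coe_iff.1 hzx) (ne_of_lt hz) h0.le ht
    · exact ((hφ.closed_lower x h).eventually_const_lt ht).mono fun _ => le_of_lt
    · obtain ⟨r, hxr, hr⟩ := EReal.lt_iff_exists_real_btwn.1 h
      filter_upwards [Ioo_mem_nhdsGT (EReal.coe_lt_coe_iff.1 hxr)] with y hy
      have : φ y = ∞ := by
        by_contra hfin
        have hle : lowerEndpoint φ ≤ y := sInf_le ⟨y, lt_top_iff_ne_top.2 hfin, rfl⟩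
        exact hy.2.not_gt (EReal.coe_lt_coe_iff.1 (hr.trans_le hle))
      simp [this]
  · simp [hφ.map_one] at ht
  · refine hconv.exists_affineMinorant_right hx hφ.map_one h0 ?_
    rcases lt_trichotomy (upperEndpoint φ) x with h | h | h
    · obtain ⟨r, hr, hrx⟩ := EReal.lt_iff_exists_real_btwn.1 h
      filter_upwards [Ioo_mem_nhdsLT (EReal.coe_lt_coe_iff.1 hrx)] with y hy
      have : φ y = ∞ := by
        by_contra hfin
        have hle : y ≤ upperEndpoint φ := le_sSup ⟨y, lt_top_iff_ne_top.2 hfin, rfl⟩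
        exact hy.1.not_gt (EReal.coe_lt_coe_iff.1 (hle.trans_lt hr))
      simp [this]
    · exact ((hφ.closed_upper x h).eventually_const_lt ht).mono fun _ => le_of_lt
    · obtain ⟨_, ⟨z, hz, rfl⟩, hzx⟩ := lt_sSup_iff.1 h
      exact hconv.eventually_le_nhdsLT (EReal.coe_lt_coe_iff.1 hzx) (ne_of_lt hz) h0.le ht

/-- A divergence function is the supremum of countably many affine functions, truncated at `0`. -/
theorem exists_seq_affineMinorant (hφ : IsDivergenceFunction φ) :
    ∃ p : ℕ → ℝ × ℝ, (∀ n, p n ∈ affineMinorants φ) ∧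
      ∀ x, φ x = ⨆ n, ENNReal.ofReal ((p n).1 * x + (p n).2) := by
  have : Nonempty (affineMinorants φ) := ⟨(0, 0), fun x => by simp⟩
  let p := TopologicalSpace.denseSeq (affineMinorants φ)
  refine ⟨fun n => p n, fun n => (p n).2, fun x => le_antisymm ?_ (iSup_le fun n => (p n).2 x)⟩
  refine le_of_forall_lt fun c hc => ?_
  obtain ⟨c', hcc', hc'⟩ := exists_between hc
  have hfin : c' ≠ ∞ := hc'.ne_top
  obtain ⟨q, hq, hlt⟩ := hφ.exists_affineMinorant (x := x)
    (ENNReal.toReal_pos (bot_le.trans_lt hcc').ne' hfin) (by rwa [ENNReal.ofReal_toReal hfin])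
  -- Exceeding a given value at `x` is an open condition on the minorant, so one countable dense
  -- family serves all `x`.
  obtain ⟨n, hn⟩ := (TopologicalSpace.denseRange_denseSeq (affineMinorants φ)).exists_mem_open
    (s := {r : affineMinorants φ | c'.toReal < r.1.1 * x + r.1.2})
    (isOpen_lt (by fun_prop) (by fun_prop)) ⟨⟨q, hq⟩, hlt⟩
  refine lt_of_lt_of_le ?_ (le_iSup _ n)
  rw [← ENNReal.ofReal_toReal hfin] at hcc'
  exact hcc'.trans_le (ENNReal.ofReal_le_ofReal (le_of_lt hn))

end IsDivergenceFunction

/-! ### Equiintegrability and setwise limits -/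

section WeakCompactness

variable {X : Type*} [MeasurableSpace X] {P : Measure X}

/-- A bounded measurable real function is a uniform limit of simple functions. -/
theorem exists_simpleFunc_dist_le {f : X → ℝ} (hf : Measurable f) {C : ℝ} (hC : ∀ x, |f x| ≤ C)
    {ε : ℝ} (hε : 0 < ε) : ∃ g : SimpleFunc X ℝ, ∀ x, |f x - g x| ≤ ε := by
  -- Round `f` down to a multiple of `ε`.
  refine ⟨⟨fun x => ε * ⌊f x / ε⌋, fun y => ?_, ?_⟩, fun x => ?_⟩
  · exact (show Measurable fun x => ε * (⌊f x / ε⌋ : ℝ) by fun_prop) (measurableSet_singleton y)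
  · refine ((Set.finite_Icc ⌊-C / ε⌋ ⌊C / ε⌋).image fun k : ℤ => ε * (k : ℝ)).subset ?_
    rintro _ ⟨x, rfl⟩
    have := abs_le.1 (hC x)
    exact ⟨_, ⟨by gcongr; exact this.1, by gcongr; exact this.2⟩, rfl⟩
  · change |f x - ε * ⌊f x / ε⌋| ≤ ε
    have h1 := Int.floor_le (f x / ε)
    have h2 := Int.lt_floor_add_one (f x / ε)
    rw [le_div_iff₀ hε] at h1
    rw [div_lt_iff₀ hε] at h2
    rw [abs_le]
    constructor <;> linarith

/-- The integral of a bounded measurable function against the signed measure with density `q`. -/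
theorem vectorMeasure_integral_withDensityᵥ {q : X → ℝ} (hqm : Measurable q) (hq : Integrable q P)
    {f : X → ℝ} (hf : Measurable f) {C : ℝ} (hC : ∀ x, |f x| ≤ C) :
    ∫ᵛ x, f x ∂•(P.withDensityᵥ q) = ∫ x, f x * q x ∂P := by
  have h1 := isFiniteMeasure_withDensity_ofReal hq.2
  have h2 := isFiniteMeasure_withDensity_ofReal hq.neg.2
  have hflip : ContinuousLinearMap.lsmul ℝ ℝ = (ContinuousLinearMap.lsmul ℝ ℝ (E := ℝ)).flip := by
    ext
    simp
  have hint : ∀ μ : Measure X, [IsFiniteMeasure μ] → Integrable f μ := fun μ _ =>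
    Integrable.of_bound hf.aestronglyMeasurable C (ae_of_all _ hC)
  rw [withDensityᵥ_eq_withDensity_pos_part_sub_withDensity_neg_part hq,
    VectorMeasure.integral_sub_vectorMeasure, hflip, VectorMeasure.integral_toSignedMeasure,
    VectorMeasure.integral_toSignedMeasure,
    integral_withDensity_eq_integral_toReal_smul (by fun_prop) (by simp),
    integral_withDensity_eq_integral_toReal_smul (by fun_prop) (by simp), ← integral_sub]
  · refine integral_congr_ae (ae_of_all _ fun x => ?_)
    simp only [smul_eq_mul, ENNReal.toReal_ofReal']
    rw [← sub_mul, max_zero_sub_max_neg_zero_eq_self, mul_comm]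
  · simp_rw [smul_eq_mul, ENNReal.toReal_ofReal']
    exact hq.pos_part.mul_bdd hf.aestronglyMeasurable (ae_of_all _ hC)
  · simp_rw [smul_eq_mul, ENNReal.toReal_ofReal']
    exact hq.neg_part.mul_bdd hf.aestronglyMeasurable (ae_of_all _ hC)
  · simp only [VectorMeasure.Integrable, Measure.variation_toSignedMeasure]
    exact hint _
  · simp only [VectorMeasure.Integrable, Measure.variation_toSignedMeasure]
    exact hint _

/-- A sequence of integrable functions whose integrals are equicontinuous with respect to `P`. -/
structure IsEquiintegrable (P : Measure X) (q : ℕ → X → ℝ) : Prop where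
  integrable : ∀ n, Integrable (q n) P
  bound : ∀ ε > 0, ∃ R : ℝ, ∀ n, ∀ A, MeasurableSet A → ∫ x in A, |q n x| ∂P ≤ R * P.real A + ε

theorem IsEquiintegrable.exists_tendsto_setIntegral {q : ℕ → X → ℝ} (hq : IsEquiintegrable P q)
    (U : Ultrafilter ℕ) {A : Set X} (hA : MeasurableSet A) :
    ∃ a, Tendsto (fun n => ∫ x in A, q n x ∂P) U (𝓝 a) := by
  obtain ⟨R, hR⟩ := hq.bound 1 one_pos
  obtain ⟨a, -, ha⟩ := (isCompact_Icc (a := -(R * P.real A + 1)) (b := R * P.real A + 1)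
    ).ultrafilter_le_nhds' (U.map fun n => ∫ x in A, q n x ∂P)
    (Ultrafilter.mem_map.2 (Filter.univ_mem' fun n =>
      abs_le.1 ((abs_integral_le_integral_abs).trans (hR n A hA))))
  exact ⟨a, ha⟩

/-- Along an ultrafilter, the indefinite integrals of an equiintegrable sequence converge setwise
to an absolutely continuous signed measure. -/
theorem IsEquiintegrable.exists_signedMeasure [IsFiniteMeasure P] {q : ℕ → X → ℝ}
    (hq : IsEquiintegrable P q) (U : Ultrafilter ℕ) :
    ∃ ν : SignedMeasure X, VectorMeasure.AbsolutelyContinuous ν P.toENNRealVectorMeasure ∧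
      ∀ A, MeasurableSet A → Tendsto (fun n => ∫ x in A, q n x ∂P) U (𝓝 (ν A)) := by
  classical
  choose! L hL using fun A hA => hq.exists_tendsto_setIntegral U (A := A) hA
  let ν : SignedMeasure X :=
    { measureOf' := fun A => if MeasurableSet A then L A else 0
      empty' := by
        rw [if_pos MeasurableSet.empty]
        exact tendsto_nhds_unique (hL ∅ .empty) (by simp)
      not_measurable' := fun A hA => if_neg hA
      m_iUnion' := by
        intro f hf hd
        simp only [hf, MeasurableSet.iUnion hf, if_true]
        have hP : HasSum (fun i => P.real (f i)) (P.real (⋃ i, f i)) := by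
          simpa [hf, MeasurableSet.iUnion hf, Measure.toSignedMeasure_apply_measurable] using
            P.toSignedMeasure.m_iUnion hf hd
        -- The tail of the union obeys the uniform bound, which survives the limit; its `P`-measure
        -- tends to `0`.
        have key : ∀ ε > 0, ∃ R, ∀ S : Finset ℕ, |L (⋃ i, f i) - ∑ i ∈ S, L (f i)| ≤
            R * (P.real (⋃ i, f i) - ∑ i ∈ S, P.real (f i)) + ε := by
          intro ε hε
          obtain ⟨R, hR⟩ := hq.bound ε hε
          refine ⟨R, fun S => ?_⟩
          have hlim := ((hL _ (MeasurableSet.iUnion hf)).sub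
            (tendsto_finsetSum S fun i _ => hL _ (hf i))).abs
          refine le_of_tendsto' hlim fun n => ?_
          have hm : MeasurableSet (⋃ i ∈ S, f i) := S.measurableSet_biUnion fun i _ => hf i
          have hsub : ⋃ i ∈ S, f i ⊆ ⋃ i, f i := Set.iUnion₂_subset_iUnion _ _
          rw [← integral_biUnion_finset S (fun i _ => hf i) (hd.set_pairwise _)
              fun i _ => (hq.integrable n).integrableOn,
            ← setIntegral_sdiff hm (hq.integrable n).integrableOn hsub,
            ← measureReal_biUnion_finset (hd.set_pairwise _) (fun i _ => hf i),
            ← measureReal_sdiff hsub hm]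
          exact abs_integral_le_integral_abs.trans (hR n _ ((MeasurableSet.iUnion hf).diff hm))
        rw [HasSum, tendsto_iff_norm_sub_tendsto_zero, Metric.tendsto_nhds]
        intro ε hε
        obtain ⟨R, hR⟩ := key (ε / 2) (half_pos hε)
        have h0 : Tendsto (fun S : Finset ℕ =>
            R * (P.real (⋃ i, f i) - ∑ i ∈ S, P.real (f i)) + ε / 2) atTop
            (𝓝 (R * (P.real (⋃ i, f i) - P.real (⋃ i, f i)) + ε / 2)) :=
          (hP.const_sub _ |>.const_mul R).add_const _
        filter_upwards [h0.eventually_lt_const (by linarith : _ < ε)] with S hS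
        rw [Real.dist_eq, sub_zero, abs_norm, Real.norm_eq_abs, abs_sub_comm]
        exact (hR S).trans_lt hS }
  have hν : ∀ A, MeasurableSet A → ν A = L A := fun A hA => if_pos hA
  refine ⟨ν, VectorMeasure.AbsolutelyContinuous.mk fun A hA hPA => ?_, fun A hA => ?_⟩
  · rw [hν A hA]
    rw [Measure.toENNRealVectorMeasure_apply_measurable hA] at hPA
    refine tendsto_nhds_unique (hL A hA) ?_
    simp [setIntegral_measure_zero _ hPA]
  · rw [hν A hA]
    exact hL A hA

/-- Setwise convergence of equiintegrable indefinite integrals implies convergence against every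
bounded measurable function. -/
theorem IsEquiintegrable.tendsto_integral_mul [IsFiniteMeasure P] {q : ℕ → X → ℝ}
    (hq : IsEquiintegrable P q) {l : Filter ℕ} {q' : X → ℝ} (hq' : Integrable q' P)
    (hlim : ∀ A, MeasurableSet A →
      Tendsto (fun n => ∫ x in A, q n x ∂P) l (𝓝 (∫ x in A, q' x ∂P)))
    {f : X → ℝ} (hf : Measurable f) {C : ℝ} (hC : ∀ x, |f x| ≤ C) :
    Tendsto (fun n => ∫ x, f x * q n x ∂P) l (𝓝 (∫ x, f x * q' x ∂P)) := by
  have hbdd : ∀ g : SimpleFunc X ℝ, ∃ D, ∀ x, ‖g x‖ ≤ D := fun g => g.exists_forall_norm_le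
  have hsi : ∀ (g : SimpleFunc X ℝ) {r : X → ℝ}, Integrable r P →
      Integrable (fun x => g x * r x) P := fun g r hr => by
    obtain ⟨D, hD⟩ := hbdd g
    exact hr.bdd_mul g.aestronglyMeasurable (ae_of_all _ hD)
  have hsimple : ∀ g : SimpleFunc X ℝ,
      Tendsto (fun n => ∫ x, g x * q n x ∂P) l (𝓝 (∫ x, g x * q' x ∂P)) := by
    intro g
    induction g using SimpleFunc.induction with
    | const c hs =>
      rename_i s
      have : ∀ r : X → ℝ, ∫ x, (SimpleFunc.piecewise s hs (SimpleFunc.const X c)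
          (SimpleFunc.const X 0)) x * r x ∂P = c * ∫ x in s, r x ∂P := by
        intro r
        rw [← integral_const_mul, ← integral_indicator hs]
        congr 1 with x
        by_cases hx : x ∈ s <;> simp [hx]
      simp_rw [this]
      exact (hlim s hs).const_mul c
    | add hd hg₁ hg₂ =>
      simp_rw [SimpleFunc.coe_add, Pi.add_apply, add_mul]
      simp_rw [integral_add (hsi _ (hq.integrable _)) (hsi _ (hq.integrable _))]
      rw [integral_add (hsi _ hq') (hsi _ hq')]
      exact hg₁.add hg₂
  obtain ⟨R, hR⟩ := hq.bound 1 one_pos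
  set M := max (R * P.real Set.univ + 1) (∫ x, |q' x| ∂P) with hM
  have hM1 : ∀ n, ∫ x, |q n x| ∂P ≤ M := fun n => by
    have := hR n _ MeasurableSet.univ
    rw [setIntegral_univ] at this
    exact this.trans (le_max_left _ _)
  have hM2 : ∫ x, |q' x| ∂P ≤ M := le_max_right _ _
  have hM0 : 0 ≤ M := (integral_nonneg fun x => abs_nonneg (q' x)).trans hM2
  have happrox : ∀ {r : X → ℝ} {g : SimpleFunc X ℝ} {δ : ℝ}, 0 ≤ δ → (∀ x, |f x - g x| ≤ δ) →
      Integrable r P → ∫ x, |r x| ∂P ≤ M →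
      |∫ x, f x * r x ∂P - ∫ x, g x * r x ∂P| ≤ δ * M := by
    intro r g δ hδ hg hr hrM
    rw [← integral_sub (hr.bdd_mul hf.aestronglyMeasurable (ae_of_all _ hC)) (hsi g hr)]
    refine abs_integral_le_integral_abs.trans ?_
    calc ∫ x, |f x * r x - g x * r x| ∂P ≤ ∫ x, δ * |r x| ∂P := by
          refine integral_mono_of_nonneg (ae_of_all _ fun x => abs_nonneg _) (hr.abs.const_mul δ)
            (ae_of_all _ fun x => ?_)
          dsimp only
          rw [← sub_mul, abs_mul]
          exact mul_le_mul_of_nonneg_right (hg x) (abs_nonneg _)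
      _ ≤ δ * M := by
          rw [integral_const_mul]
          exact mul_le_mul_of_nonneg_left hrM hδ
  rw [Metric.tendsto_nhds]
  intro ε hε
  -- Replacing `f` by `g` costs at most `ε / 4` on each side; `+ 1` covers `M = 0`.
  have hδ : 0 < ε / (4 * (M + 1)) := by positivity
  obtain ⟨g, hg⟩ := exists_simpleFunc_dist_le hf hC hδ
  have hδM : ε / (4 * (M + 1)) * M ≤ ε / 4 := by
    rw [div_mul_eq_mul_div, div_le_div_iff₀ (by positivity) (by positivity)]
    nlinarith
  filter_upwards [(Metric.tendsto_nhds.1 (hsimple g)) (ε / 4) (by positivity)] with n hn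
  rw [Real.dist_eq] at hn ⊢
  have h1 := abs_le.1 (happrox hδ.le hg (hq.integrable n) (hM1 n))
  have h2 := abs_le.1 (happrox hδ.le hg hq' hM2)
  have h3 := abs_lt.1 hn
  rw [abs_lt]
  constructor <;> linarith

end WeakCompactness

/-! ### Lower semicontinuity and the growth criterion -/

section LowerSemicontinuity

variable {X : Type*} [MeasurableSpace X] {P : Measure X}

theorem ofReal_integral_le_lintegral_ofReal {g : X → ℝ} (hg : Integrable g P) :
    ENNReal.ofReal (∫ x, g x ∂P) ≤ ∫⁻ x, ENNReal.ofReal (g x) ∂P := by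
  calc ENNReal.ofReal (∫ x, g x ∂P) ≤ ENNReal.ofReal (∫ x, max (g x) 0 ∂P) :=
        ENNReal.ofReal_le_ofReal (integral_mono hg hg.pos_part fun x => le_max_left _ _)
    _ = ∫⁻ x, ENNReal.ofReal (max (g x) 0) ∂P :=
        ofReal_integral_eq_lintegral_ofReal hg.pos_part (ae_of_all _ fun x => le_max_right _ _)
    _ = ∫⁻ x, ENNReal.ofReal (g x) ∂P := by simp

/-- Measurable selection of a dominating affine minorant among finitely many. -/
theorem exists_measurable_affineMinorant {φ : ℝ → ℝ≥0∞} {p : ℕ → ℝ × ℝ}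
    (hp : ∀ n, p n ∈ affineMinorants φ) {q : X → ℝ} (hq : Measurable q) (N : ℕ) :
    ∃ s r : X → ℝ, Measurable s ∧ Measurable r ∧ (∃ C, ∀ x, |s x| ≤ C) ∧ (∃ C, ∀ x, |r x| ≤ C) ∧
      (∀ x, (s x, r x) ∈ affineMinorants φ) ∧ (∀ x, 0 ≤ s x * q x + r x) ∧
      ∀ k < N, ∀ x, (p k).1 * q x + (p k).2 ≤ s x * q x + r x := by
  classical
  induction N with
  | zero =>
    -- Starting from the zero minorant keeps the selected value nonnegative.
    exact ⟨0, 0, measurable_const, measurable_const, ⟨0, by simp⟩, ⟨0, by simp⟩,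
      fun x y => by simp, by simp, by simp⟩
  | succ N ih =>
    obtain ⟨s, r, hs, hr, ⟨C, hC⟩, ⟨D, hD⟩, hmem, hnn, hle⟩ := ih
    set A : Set X := {x | (p N).1 * q x + (p N).2 ≤ s x * q x + r x} with hA
    have hAm : MeasurableSet A := measurableSet_le (by fun_prop) (by fun_prop)
    have hval : ∀ x, s x * q x + r x ≤ A.piecewise s (fun _ => (p N).1) x * q x +
          A.piecewise r (fun _ => (p N).2) x ∧
        (p N).1 * q x + (p N).2 ≤ A.piecewise s (fun _ => (p N).1) x * q x +
          A.piecewise r (fun _ => (p N).2) x := fun x => by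
      by_cases hx : x ∈ A
      · simp only [Set.piecewise_eq_of_mem _ _ _ hx]
        exact ⟨le_rfl, hx⟩
      · simpa [hx] using le_of_not_ge hx
    refine ⟨A.piecewise s fun _ => (p N).1, A.piecewise r fun _ => (p N).2,
      hs.piecewise hAm measurable_const, hr.piecewise hAm measurable_const,
      ⟨max C |(p N).1|, fun x => ?_⟩, ⟨max D |(p N).2|, fun x => ?_⟩, fun x => ?_,
      fun x => (hnn x).trans (hval x).1, fun k hk x => ?_⟩
    · by_cases hx : x ∈ A <;> simp [hx, hC]
    · by_cases hx : x ∈ A <;> simp [hx, hD]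
    · by_cases hx : x ∈ A
      · simpa [hx] using hmem x
      · simpa [hx] using hp N
    · rcases Nat.lt_succ_iff_lt_or_eq.1 hk with h | rfl
      · exact (hle k h x).trans (hval x).1
      · exact (hval x).2

/-- Lower semicontinuity of `q ↦ ∫ φ(q) dP` under setwise convergence of indefinite integrals. -/
theorem IsEquiintegrable.lintegral_le_of_tendsto [IsFiniteMeasure P] {φ : ℝ → ℝ≥0∞}
    (hφ : IsDivergenceFunction φ) {q : ℕ → X → ℝ} (hq : IsEquiintegrable P q) {l : Filter ℕ}
    [l.NeBot] {q' : X → ℝ} (hqm : Measurable q') (hq' : Integrable q' P)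
    (hlim : ∀ A, MeasurableSet A →
      Tendsto (fun n => ∫ x in A, q n x ∂P) l (𝓝 (∫ x in A, q' x ∂P)))
    {I : ℕ → ℝ≥0∞} {m : ℝ≥0∞} (hI : Tendsto I l (𝓝 m)) (hqI : ∀ n, ∫⁻ x, φ (q n x) ∂P ≤ I n) :
    ∫⁻ x, φ (q' x) ∂P ≤ m := by
  obtain ⟨p, hp, hsup⟩ := hφ.exists_seq_affineMinorant
  let f : ℕ → X → ℝ≥0∞ := fun n x => ENNReal.ofReal ((p n).1 * q' x + (p n).2)
  have hf : ∀ n, Measurable (f n) := fun n => by fun_prop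
  have hpf : ∀ n, Measurable (partialSups f n) := fun n => by
    induction n with
    | zero => simpa using hf 0
    | succ n ih =>
      rw [partialSups_add_one]
      exact ih.sup (hf _)
  have heq : (fun x => φ (q' x)) = fun x => ⨆ n, partialSups f n x := by
    funext x
    rw [hsup, ← iSup_apply, iSup_partialSups_eq, iSup_apply]
  rw [heq, lintegral_iSup hpf (partialSups f).monotone]
  refine iSup_le fun N => ?_
  -- `N + 1`, because `partialSups f N` includes index `N`.
  obtain ⟨s, r, hs, hr, ⟨C, hC⟩, ⟨D, hD⟩, hmem, hnn, hle⟩ :=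
    exists_measurable_affineMinorant hp hqm (N + 1)
  have hri : Integrable r P := Integrable.of_bound hr.aestronglyMeasurable D (ae_of_all _ hD)
  have hsi : ∀ {u : X → ℝ}, Integrable u P → Integrable (fun x => s x * u x) P :=
    fun hu => hu.bdd_mul hs.aestronglyMeasurable (ae_of_all _ hC)
  have hle' : partialSups f N ≤ fun x => ENNReal.ofReal (s x * q' x + r x) :=
    partialSups_le _ _ _ fun k hk x => ENNReal.ofReal_le_ofReal (hle k (Nat.lt_succ_of_le hk) x)
  calc ∫⁻ x, partialSups f N x ∂P ≤ ∫⁻ x, ENNReal.ofReal (s x * q' x + r x) ∂P :=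
        lintegral_mono hle'
    _ = ENNReal.ofReal (∫ x, s x * q' x + r x ∂P) :=
        (ofReal_integral_eq_lintegral_ofReal ((hsi hq').add hri) (ae_of_all _ hnn)).symm
    _ ≤ m := by
        rw [integral_add (hsi hq') hri]
        refine le_of_tendsto_of_tendsto' (ENNReal.tendsto_ofReal
          ((hq.tendsto_integral_mul hq' hlim hs hC).add_const (∫ x, r x ∂P))) hI fun n => ?_
        rw [← integral_add (hsi (hq.integrable n)) hri]
        refine (ofReal_integral_le_lintegral_ofReal ((hsi (hq.integrable n)).add hri)).trans ?_
        -- The pair chosen for `q'` is a minorant everywhere, so it also bounds `φ` at `q n x`.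
        exact (lintegral_mono fun x => hmem x (q n x)).trans (hqI n)

/-- Superlinear growth bounds `|x|` by a constant plus a small multiple of `φ x`. -/
theorem exists_abs_le_add_mul {φ : ℝ → ℝ≥0∞}
    (hgrowth : Tendsto (fun x : ℝ => φ x / ENNReal.ofReal |x|)
      (comap (fun x : ℝ => |x|) atTop) (𝓝 ∞)) {ε : ℝ} (hε : 0 < ε) :
    ∃ R : ℝ, 0 ≤ R ∧ ∀ x, ENNReal.ofReal |x| ≤ ENNReal.ofReal R + ENNReal.ofReal ε * φ x := by
  have hev := hgrowth.eventually_const_lt (ENNReal.ofReal_lt_top (r := ε⁻¹))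
  rw [eventually_comap, eventually_atTop] at hev
  obtain ⟨R, hR⟩ := hev
  refine ⟨max R 0, le_max_right _ _, fun x => ?_⟩
  rcases le_total |x| (max R 0) with h | h
  · exact (ENNReal.ofReal_le_ofReal h).trans le_self_add
  · refine le_add_left ?_
    have h1 := ENNReal.mul_le_of_le_div (hR |x| ((le_max_left _ _).trans h) x rfl).le
    calc ENNReal.ofReal |x| = ENNReal.ofReal ε * (ENNReal.ofReal ε⁻¹ * ENNReal.ofReal |x|) := by
          rw [← mul_assoc, ← ENNReal.ofReal_mul hε.le, mul_inv_cancel₀ hε.ne', ENNReal.ofReal_one,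
            one_mul]
      _ ≤ _ := by gcongr

/-- De la Vallée-Poussin criterion. -/
theorem isEquiintegrable_of_lintegral_le [IsFiniteMeasure P] {φ : ℝ → ℝ≥0∞}
    (hgrowth : Tendsto (fun x : ℝ => φ x / ENNReal.ofReal |x|)
      (comap (fun x : ℝ => |x|) atTop) (𝓝 ∞)) {q : ℕ → X → ℝ} (hq : ∀ n, Integrable (q n) P)
    {K : ℝ≥0∞} (hK : K ≠ ∞) (hqK : ∀ n, ∫⁻ x, φ (q n x) ∂P ≤ K) : IsEquiintegrable P q := by
  refine ⟨hq, fun ε hε => ?_⟩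
  have hδ : 0 < ε / (K.toReal + 1) := by positivity
  obtain ⟨R, hR0, hR⟩ := exists_abs_le_add_mul hgrowth hδ
  refine ⟨R, fun n A _ => ?_⟩
  have hδK : ε / (K.toReal + 1) * K.toReal ≤ ε := by
    rw [div_mul_eq_mul_div, div_le_iff₀ (by positivity)]
    nlinarith
  have hnn : 0 ≤ R * P.real A := by positivity
  rw [← ENNReal.ofReal_le_ofReal_iff (by positivity),
    ofReal_integral_eq_lintegral_ofReal (hq n).abs.integrableOn (ae_of_all _ fun x => abs_nonneg _)]
  calc ∫⁻ x in A, ENNReal.ofReal |q n x| ∂P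
      ≤ ∫⁻ x in A, ENNReal.ofReal R + ENNReal.ofReal (ε / (K.toReal + 1)) * φ (q n x) ∂P :=
        lintegral_mono fun x => hR _
    _ = ENNReal.ofReal R * P A + ENNReal.ofReal (ε / (K.toReal + 1)) * ∫⁻ x in A, φ (q n x) ∂P := by
        rw [lintegral_add_left measurable_const, setLIntegral_const,
          lintegral_const_mul' _ _ ENNReal.ofReal_ne_top]
    _ ≤ ENNReal.ofReal R * P A + ENNReal.ofReal (ε / (K.toReal + 1)) * K := by
        gcongr
        exact (setLIntegral_le_lintegral _ _).trans (hqK n)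
    _ = ENNReal.ofReal (R * P.real A) + ENNReal.ofReal (ε / (K.toReal + 1) * K.toReal) := by
        rw [ENNReal.ofReal_mul hR0, ENNReal.ofReal_mul hδ.le, ENNReal.ofReal_toReal hK,
          ofReal_measureReal]
    _ ≤ ENNReal.ofReal (R * P.real A + ε) := by
        rw [← ENNReal.ofReal_add hnn (by positivity)]
        exact ENNReal.ofReal_le_ofReal (by linarith)

end LowerSemicontinuity

/-! ### The `τ`-limit of a minimising sequence -/

/-- Convergence in the `τ`-topology is convergence of the integrals of bounded measurable
functions. -/
theorem tendsto_nhds_tauTopology {X : Type*} [MeasurableSpace X] {ι : Type*} {l : Filter ι}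
    {Q : ι → SignedMeasure X} {Q' : SignedMeasure X}
    (h : ∀ f : X → ℝ, Measurable f → (∃ C : ℝ, ∀ x, |f x| ≤ C) →
      Tendsto (fun i => ∫ᵛ x, f x ∂•(Q i)) l (𝓝 (∫ᵛ x, f x ∂•Q'))) :
    Tendsto Q l (@nhds _ (tauTopology X) Q') := by
  simp only [nhds_iInf, nhds_induced, tendsto_iInf, tendsto_comap_iff]
  exact h

theorem withDensityᵥ_rnDeriv_of_phiDiv_ne_top {X : Type*} [MeasurableSpace X] {P : Measure X}
    [IsFiniteMeasure P] {φ : ℝ → ℝ≥0∞} {Q : SignedMeasure X} (h : phiDiv φ Q P ≠ ∞) :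
    P.withDensityᵥ (Q.rnDeriv P) = Q ∧ phiDiv φ Q P = ∫⁻ x, φ (Q.rnDeriv P x) ∂P := by
  have hac : VectorMeasure.AbsolutelyContinuous Q P.toENNRealVectorMeasure := by
    by_contra hac
    exact h (if_neg hac)
  exact ⟨Q.withDensityᵥ_rnDeriv_eq P hac, if_pos hac⟩

theorem mainTheorem4 {X : Type*} [MeasurableSpace X] (P : Measure X) [IsProbabilityMeasure P]
    (φ : ℝ → ℝ≥0∞) (hφ : IsDivergenceFunction φ)
    (Ω : Set (SignedMeasure X)) (hΩ : IsClosed[tauTopology X] Ω)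
    (hfin : phiDivSet φ Ω P < ∞)
    (hgrowth : Tendsto (fun x : ℝ => φ x / ENNReal.ofReal |x|)
      (comap (fun x : ℝ => |x|) atTop) (𝓝 ∞)) :
    ∃ Q : SignedMeasure X, IsPhiProjection φ P Ω Q := by
  set m := phiDivSet φ Ω P with hm
  have hmin : ∀ n : ℕ, ∃ Q ∈ Ω, phiDiv φ Q P < m + (n + 1 : ℝ≥0∞)⁻¹ := by
    intro n
    have : m < m + (n + 1 : ℝ≥0∞)⁻¹ := ENNReal.lt_add_right hfin.ne (by simp)
    obtain ⟨Q, hQ⟩ := iInf_lt_iff.1 this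
    obtain ⟨hQΩ, hQ⟩ := iInf_lt_iff.1 hQ
    exact ⟨Q, hQΩ, hQ⟩
  choose Q hQΩ hQ using hmin
  have hQ' : ∀ n, phiDiv φ (Q n) P ≤ m + 1 := fun n =>
    (hQ n).le.trans (by gcongr; simp)
  have hdens := fun n => withDensityᵥ_rnDeriv_of_phiDiv_ne_top
    (ne_top_of_le_ne_top (by finiteness) (hQ' n))
  set q : ℕ → X → ℝ := fun n => (Q n).rnDeriv P with hq
  have hequi : IsEquiintegrable P q :=
    isEquiintegrable_of_lintegral_le hgrowth (fun n => (Q n).integrable_rnDeriv P)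
      (K := m + 1) (by finiteness) fun n => (hdens n).2 ▸ hQ' n
  -- An ultrafilter finer than `atTop` replaces the extraction of a subsequence.
  let U : Ultrafilter ℕ := Ultrafilter.of atTop
  have hU : (U : Filter ℕ) ≤ atTop := Ultrafilter.of_le atTop
  obtain ⟨ν, hν, hlim⟩ := hequi.exists_signedMeasure U
  have hνd := ν.withDensityᵥ_rnDeriv_eq P hν
  have hνi := ν.integrable_rnDeriv P
  have hνm := ν.measurable_rnDeriv P
  have hlim' : ∀ A, MeasurableSet A →
      Tendsto (fun n => ∫ x in A, q n x ∂P) U (𝓝 (∫ x in A, ν.rnDeriv P x ∂P)) := fun A hA => by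
    rw [← withDensityᵥ_apply hνi hA, hνd]
    exact hlim A hA
  have htau : Tendsto Q U (@nhds _ (tauTopology X) ν) := by
    refine tendsto_nhds_tauTopology fun f hf ⟨C, hC⟩ => ?_
    have h := hequi.tendsto_integral_mul hνi hlim' hf hC
    rw [← vectorMeasure_integral_withDensityᵥ hνm hνi hf hC, hνd] at h
    refine h.congr fun n => ?_
    rw [← vectorMeasure_integral_withDensityᵥ ((Q n).measurable_rnDeriv P)
      ((Q n).integrable_rnDeriv P) hf hC, (hdens n).1]
  have hνΩ : ν ∈ Ω :=
    letI := tauTopology X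
    IsClosed.mem_of_tendsto hΩ htau (Eventually.of_forall hQΩ)
  have hI : Tendsto (fun n : ℕ => m + (n + 1 : ℝ≥0∞)⁻¹) U (𝓝 m) := by
    have h : Tendsto (fun n : ℕ => ((n + 1 : ℕ) : ℝ≥0∞)⁻¹) atTop (𝓝 0) :=
      ENNReal.tendsto_inv_nat_nhds_zero.comp (tendsto_add_atTop_nat 1)
    simpa using (h.const_add m).mono_left hU
  have hle : phiDiv φ ν P ≤ m := by
    rw [phiDiv, if_pos hν]
    exact hequi.lintegral_le_of_tendsto hφ hνm hνi hlim' hI fun n => (hdens n).2 ▸ (hQ n).le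
  exact ⟨ν, hνΩ, fun R hR => hle.trans (iInf₂_le R hR)⟩
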